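/- **Setting.** A market $I$ consists of $n\ge 1$ sellers; seller $i$ owns one divisible item of public utility $u_i>0$ and private cost $c_i\ge 0$, and $\gamma_i=c_i/u_i$ is the seller's cost-per-utility. For a budget $B>0$ the non-IC optimum $\mathrm{OPT}(I,B)$ is the maximum of $\sum_i x_iu_i$ over $x\in[0,1]^n$ with $\sum_i x_ic_i\le B$. A deterministic mechanism maps every number of sellers $n$, every vector of public utilities $u$, every budget $B$ and every vector of reports $\vec\gamma\in\mathbb R_{\ge0}^n$ to an allocation in $[0,1]^n$ and to payments per utility in $\mathbb R_{\ge0}^n$. A randomized mechanism $\mathcal M$ is a probability distribution over deterministic mechanisms (depending measurably on the budget and the randomness); let $g$ and $Q$ denote its expected allocation and its expected payments per utility. The following are required for all $n$, all $u$ with positive entries, all $B>0$ and all $\vec\gamma$. * $\mathcal M$ is truthful-in-expectation if $Q(\gamma_i,\gamma_{-i})_iu_i-g(\gamma_i,\gamma_{-i})_i\gamma_iu_i\ge Q(z,\gamma_{-i})_iu_i-g(z,\gamma_{-i})_i\gamma_iu_i$ for all $i$ and all $z\ge0$. * $\mathcal M$ is individually rational (in expectation) if $Q(\vec\gamma)_iu_i\ge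 g(\vec\gamma)_i\gamma_iu_i$ for all $i$. * $\mathcal M$ is strictly budget-feasible if, almost surely, the total payment (the sum over $i$ of $u_i$ times the realized payment per utility of seller $i$) is at most $B$. The competitive ratio $\mathcal R_{\mathcal M}(I,B)$ is the expected utility $\sum_i g(\vec\gamma)_iu_i$ of $\mathcal M$ on $(I,B)$ under truthful reports, divided by $\mathrm{OPT}(I,B)$. A market is *$\varepsilon$-nearly geometric* with $m$ and cost unit $\kappa>0$ if its sellers can be split into groups $0,\dots,m$ such that within each group all sellers have equal utilities and equal cost-per-utility; the cost-per-utility is $0$ in group $0$ and $\kappa(1+1/\sqrt2)^{j-1}$ in group $j\ge1$; and the total utility of the group differs by at most $\varepsilon$ from $1$ for $j=0$ and from $2^{j-1}$ for $j\ge1$. **Theorem.** Let $D$ be any probability distribution of budget perturbations $\rho>0$, let $B_0>0$ be any base budget, and let $\mathcal M$ be any truthful-in-expectation, individually rational and strictly budget-feasible randomized mechanism. Then for all $\varepsilon,\delta>0$ there are an integer $m\ge 0$, a $\kappa>0$ and a market $I$, $\varepsilon$-nearly geometric with $m$ and $\kappa$, in which every seller's cost is at most $\delta B_0$ (small bidders),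 such that the expected competitive ratio $\mathbb E_{\rho\sim D}[\mathcal R_{\mathcal M}(I,\rho B_0)]$ exists and satisfies $$\mathbb E_{\rho\sim D}\big[\mathcal R_{\mathcal M}(I,\rho B_0)\big]\le 0.854\qquad\text{and}\qquad \mathbb E_{\rho\sim D}\big[\mathcal R_{\mathcal M}(I,\rho B_0)\big]\le\frac{2+\sqrt2}{4}+\varepsilon .$$ -/

import Mathlib

open MeasureTheory
open scoped NNReal

noncomputable section

/-- A procurement market: `n ≥ 1` sellers, seller `i` owning one divisible item of public utility
`u i > 0` and private cost `c i ≥ 0`. -/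
structure Market where
  n : ℕ
  n_pos : 0 < n
  u : Fin n → ℝ≥0
  c : Fin n → ℝ≥0
  u_pos : ∀ i, 0 < u i

/-- The cost-per-utility of seller `i`. -/
def Market.γ (I : Market) (i : Fin I.n) : ℝ≥0 := I.c i / I.u i

/-- The non-IC optimum: the optimal value of the fractional knapsack problem with the true costs
and budget `B`. -/
def Market.opt (I : Market) (B : ℝ≥0) : ℝ :=
  sSup {v : ℝ | ∃ x : Fin I.n → ℝ, (∀ i, 0 ≤ x i ∧ x i ≤ 1) ∧
    ∑ i, x i * (I.c i : ℝ) ≤ (B : ℝ) ∧ v = ∑ i, x i * (I.u i : ℝ)}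

/-- A deterministic direct mechanism. Given the number of sellers, the public utilities, the
budget and the reported costs-per-utility, it returns for each seller the purchased fraction of
the item and the payment per utility (seller `i` receives `pay … i * u i`). -/
structure DetMechanism where
  alloc : (n : ℕ) → (u : Fin n → ℝ≥0) → (B : ℝ≥0) → (γ : Fin n → ℝ≥0) → Fin n → ℝ≥0
  pay : (n : ℕ) → (u : Fin n → ℝ≥0) → (B : ℝ≥0) → (γ : Fin n → ℝ≥0) → Fin n → ℝ≥0
  alloc_le_one : ∀ n u B γ i, alloc n u B γ i ≤ 1

/-- A randomized mechanism: a distribution over deterministic mechanisms, given as a family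
indexed by a probability space. -/
structure RandomizedMechanism (Ω : Type*) [MeasurableSpace Ω] where
  P : Measure Ω
  isProb : IsProbabilityMeasure P
  det : Ω → DetMechanism
  measurable_alloc : ∀ n u γ i,
    Measurable fun x : ℝ≥0 × Ω => (det x.2).alloc n u x.1 γ i
  measurable_pay : ∀ n u γ i,
    Measurable fun x : ℝ≥0 × Ω => (det x.2).pay n u x.1 γ i

namespace RandomizedMechanism

variable {Ω : Type*} [MeasurableSpace Ω]

/-- The expected allocation function. -/
def expAlloc (M : RandomizedMechanism Ω) (n : ℕ) (u : Fin n → ℝ≥0) (B : ℝ≥0)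
    (γ : Fin n → ℝ≥0) (i : Fin n) : ℝ :=
  ∫ ω, ((M.det ω).alloc n u B γ i : ℝ) ∂M.P

/-- The expected payment-per-utility function. -/
def expPay (M : RandomizedMechanism Ω) (n : ℕ) (u : Fin n → ℝ≥0) (B : ℝ≥0)
    (γ : Fin n → ℝ≥0) (i : Fin n) : ℝ :=
  ∫ ω, ((M.det ω).pay n u B γ i : ℝ) ∂M.P

/-- Whatever the others report, reporting the true cost-per-utility `γ i` maximizes the expected
net profit of seller `i`, whose cost is `γ i * u i`. -/
def TruthfulInExpectation (M : RandomizedMechanism Ω) : Prop :=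
  ∀ (n : ℕ) (u : Fin n → ℝ≥0), (∀ i, 0 < u i) → ∀ B : ℝ≥0, 0 < B →
    ∀ (γ : Fin n → ℝ≥0) (i : Fin n) (z : ℝ≥0),
      M.expPay n u B (Function.update γ i z) i * (u i : ℝ)
          - M.expAlloc n u B (Function.update γ i z) i * ((γ i : ℝ) * (u i : ℝ))
        ≤ M.expPay n u B γ i * (u i : ℝ)
          - M.expAlloc n u B γ i * ((γ i : ℝ) * (u i : ℝ))

/-- A truthful seller has nonnegative expected net profit. -/
def IndividuallyRational (M : RandomizedMechanism Ω) : Prop :=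
  ∀ (n : ℕ) (u : Fin n → ℝ≥0), (∀ i, 0 < u i) → ∀ B : ℝ≥0, 0 < B →
    ∀ (γ : Fin n → ℝ≥0) (i : Fin n),
      M.expAlloc n u B γ i * ((γ i : ℝ) * (u i : ℝ)) ≤ M.expPay n u B γ i * (u i : ℝ)

/-- Strict budget feasibility: on every input the total payment is almost surely (not merely in
expectation) at most the budget. -/
def BudgetFeasible (M : RandomizedMechanism Ω) : Prop :=
  ∀ (n : ℕ) (u : Fin n → ℝ≥0), (∀ i, 0 < u i) → ∀ B : ℝ≥0, 0 < B →
    ∀ γ : Fin n → ℝ≥0, ∀ᵐ ω ∂M.P, ∑ i, (M.det ω).pay n u B γ i * u i ≤ B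

/-- The competitive ratio on `(I, B)`: expected utility under truthful reports over the non-IC
optimum. The optimum is positive when `B > 0`. -/
def competitiveRatio (M : RandomizedMechanism Ω) (I : Market) (B : ℝ≥0) : ℝ :=
  (∑ i, M.expAlloc I.n I.u B I.γ i * (I.u i : ℝ)) / I.opt B

end RandomizedMechanism

/-- Total utility of the `j`-th geometric group: `1` for `j = 0` and `2 ^ (j - 1)` for `j ≥ 1`. -/
def groupUtility (j : ℕ) : ℝ := if j = 0 then 1 else 2 ^ (j - 1)

/-- Cost-per-utility of the `j`-th geometric group: `0` for `j = 0` and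
`(1 + 1 / √2) ^ (j - 1)` for `j ≥ 1`. -/
def groupCostRatio (j : ℕ) : ℝ := if j = 0 then 0 else (1 + 1 / √2) ^ (j - 1)

/-- The sellers split into groups `0, …, m`. The sellers of group `j` have equal utilities and
cost-per-utility `κ * groupCostRatio j` (`κ` is the unit in which costs are measured), and their
total utility is `groupUtility j` up to an error `ε`. -/
def Market.IsNearlyGeometric (I : Market) (m : ℕ) (κ ε : ℝ) : Prop :=
  ∃ k : Fin I.n → Fin (m + 1),
    (∀ i, (I.γ i : ℝ) = κ * groupCostRatio (k i)) ∧
    (∀ i i', k i = k i' → I.u i = I.u i') ∧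
    ∀ j : Fin (m + 1),
      |∑ i ∈ Finset.univ.filter (fun i => k i = j), (I.u i : ℝ) - groupUtility j| ≤ ε

end

/-!
# Hardness of budget-smoothed procurement

Seller types are drawn independently from the geometric distribution. Truthfulness bounds the
expected utility by a mixture of posted prices, the sampled market is nearly geometric with high
probability, and on such markets the optimum exceeds every mixture of posted prices by the factor
`4 - 2√2`.
-/

/-! ### The geometric sequences -/

/-! The argument averages over random markets. Draw the groups of `n` equal sellers independently,
with probabilities proportional to `groupUtility`. Averaging a seller's expected allocation and
payment over the other sellers' types and over all sellers gives interim sequences `x j`, `p j`.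
Truthfulness and individual rationality make them a mixture of posted prices: posting the cost of
group `j` buys utility `2 ^ j` and pays the cost of group `j` times `2 ^ j`. Hence, for any line
above all these points, its value at budget `B` bounds the expected utility
(`sum_profileWeight_expAlloc_le`).

The optimum pays true costs instead. At the budget of posted price `N + 1` it buys groups up to `N +
1` and still affords a fraction `3 - 2√2` of the next group, gaining the factor `4 - 2√2 = 1 / ((2 +
√2) / 4)`. Concavity of the optimum extends this to budgets between consecutive posted prices
(`Market.line_le_opt`). The construction is self-similar under scaling the budget by `2 + √2`, so
the gap holds for every budget in a range that grows with `m`; perturbing the budget does not help.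

The range is chosen to carry almost all of `D`, and Chebyshev's inequality makes the sampled market
nearly geometric with high probability. Some nearly geometric sample is then at most the average, up
to small errors. -/

lemma groupUtility_succ (j : ℕ) : groupUtility (j + 1) = 2 ^ j := by simp [groupUtility]

lemma groupUtility_zero : groupUtility 0 = 1 := by simp [groupUtility]

lemma one_le_groupUtility (j : ℕ) : 1 ≤ groupUtility j := by
  rcases j with _ | j
  · rw [groupUtility_zero]
  · rw [groupUtility_succ]; exact one_le_pow₀ (by norm_num)

lemma groupCostRatio_zero : groupCostRatio 0 = 0 := by simp [groupCostRatio]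

lemma groupCostRatio_succ (j : ℕ) : groupCostRatio (j + 1) = (1 + 1 / √2) ^ j := by
  simp [groupCostRatio]

lemma groupCostRatio_nonneg (j : ℕ) : 0 ≤ groupCostRatio j := by
  unfold groupCostRatio; split_ifs <;> positivity

lemma sq_sqrt_two : √2 * √2 = (2 : ℝ) := Real.mul_self_sqrt (by norm_num)

lemma sqrt_two_bounds : 1.414 < √2 ∧ √2 < 1.415 :=
  ⟨Real.lt_sqrt_of_sq_lt (by norm_num), (Real.sqrt_lt' (by norm_num)).2 (by norm_num)⟩

lemma two_mul_ratio : 2 * (1 + 1 / √2) = 2 + √2 := by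
  have h := sq_sqrt_two
  have : (0 : ℝ) < √2 := by positivity
  field_simp
  nlinarith

lemma groupCostRatio_succ_mul_two_pow (j : ℕ) :
    groupCostRatio (j + 1) * 2 ^ j = (2 + √2) ^ j := by
  rw [groupCostRatio_succ, ← two_mul_ratio, mul_pow, mul_comm]

lemma sum_groupUtility (k : ℕ) : ∑ j ∈ Finset.range (k + 1), groupUtility j = 2 ^ k := by
  induction k with
  | zero => simp [groupUtility_zero]
  | succ k ih => rw [Finset.sum_range_succ, ih, groupUtility_succ]; ring

/-- In units of `κ`, this is the true cost of the first groups. Posting the price of group `k` pays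
`groupCostRatio k * 2 ^ k` for them, and the optimum exploits the difference. -/
lemma sum_groupCostRatio_mul_groupUtility (k : ℕ) :
    ∑ j ∈ Finset.range (k + 1), groupCostRatio j * groupUtility j
      = (√2 - 1) * ((2 + √2) ^ k - 1) := by
  induction k with
  | zero => simp [groupCostRatio_zero]
  | succ k ih =>
    rw [Finset.sum_range_succ, ih, groupUtility_succ, groupCostRatio_succ_mul_two_pow, pow_succ]
    linear_combination (-(2 + √2) ^ k) * sq_sqrt_two

/-! ### The virtual-cost bound -/

/-- Summation by parts against the cumulative utilities `2 ^ j`: in a mixture of posted prices, the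
price of group `j` has weight `x j - x (j + 1)`. -/
lemma sum_groupUtility_mul (x : ℕ → ℝ) (m : ℕ) :
    ∑ j ∈ Finset.range (m + 1), groupUtility j * x j
      = ∑ j ∈ Finset.range m, 2 ^ j * (x j - x (j + 1)) + 2 ^ m * x m := by
  induction m with
  | zero => simp [groupUtility_zero]
  | succ m ih =>
    rw [Finset.sum_range_succ, ih, Finset.sum_range_succ, groupUtility_succ]; ring

/-- Weak duality: an affine function above all posted-price outcomes bounds the utility of every
incentive compatible allocation `x` with payments `p`. -/
lemma sum_groupUtility_mul_le {x p γ : ℕ → ℝ} {m : ℕ} {a b B : ℝ}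
    (hIC : ∀ j < m, p (j + 1) + γ j * (x j - x (j + 1)) ≤ p j)
    (hIR : γ m * x m ≤ p m)
    (hmono : ∀ j < m, x (j + 1) ≤ x j) (hx : 0 ≤ x m) (hx1 : x 0 ≤ 1)
    (hB : ∑ j ∈ Finset.range (m + 1), groupUtility j * p j ≤ B)
    (ha : 0 ≤ a) (hb : 0 ≤ b) (hab : ∀ j, 2 ^ j ≤ a + b * (γ j * 2 ^ j)) :
    ∑ j ∈ Finset.range (m + 1), groupUtility j * x j ≤ a + b * B := by
  -- Each layer is bounded by the line at its posted price; incentive compatibility replaces the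
  -- price of the layer by a payment difference, which sums back by parts to the total payment.
  have key : ∑ j ∈ Finset.range m, 2 ^ j * (x j - x (j + 1)) ≤
      ∑ j ∈ Finset.range m, (a * (x j - x (j + 1)) + b * (2 ^ j * (p j - p (j + 1)))) := by
    refine Finset.sum_le_sum fun j hj => ?_
    rw [Finset.mem_range] at hj
    have h1 := mul_le_mul_of_nonneg_right (hab j) (sub_nonneg.2 (hmono j hj))
    have h2 : γ j * (x j - x (j + 1)) ≤ p j - p (j + 1) := by linarith [hIC j hj]
    have h3 := mul_le_mul_of_nonneg_left h2 (show 0 ≤ b * 2 ^ j by positivity)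
    nlinarith
  rw [Finset.sum_add_distrib, ← Finset.mul_sum, ← Finset.mul_sum, Finset.sum_range_sub'] at key
  rw [sum_groupUtility_mul] at hB ⊢
  have h1 := mul_le_mul_of_nonneg_right (hab m) hx
  have h2 := mul_le_mul_of_nonneg_left hIR (show 0 ≤ b * 2 ^ m by positivity)
  have h3 := mul_le_mul_of_nonneg_left hB hb
  have h4 := mul_le_mul_of_nonneg_left hx1 ha
  nlinarith

/-- The right side is the chord through the points `d = 0` and `d = 1`; the points `((2 + √2) ^ d, 2
^ d)` lie on a concave curve, so later ones fall below it. -/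
lemma two_pow_le_affine (d : ℕ) : (2 : ℝ) ^ d ≤ (2 - √2) + (√2 - 1) * (2 + √2) ^ d := by
  induction d with
  | zero => norm_num
  | succ d ih =>
    have h := sq_sqrt_two
    have h1 : (1 : ℝ) ≤ (2 + √2) ^ d := one_le_pow₀ (by linarith [sqrt_two_bounds.1])
    have h2 := mul_le_mul_of_nonneg_left h1 (show 0 ≤ 2 - √2 by linarith [sqrt_two_bounds.2])
    rw [pow_succ, pow_succ]
    have : (√2 - 1) * ((2 + √2) ^ d * (2 + √2))
        = 2 * ((√2 - 1) * (2 + √2) ^ d) + (2 - √2) * (2 + √2) ^ d := by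
      linear_combination (2 + √2) ^ d * h
    linarith

/-- The line through the outcomes of the posted prices `N + 1` and `N + 2` lies above the outcomes
of all posted prices. -/
lemma two_pow_le_line {κ : ℝ} (hκ : 0 < κ) (N j : ℕ) :
    (2 : ℝ) ^ j ≤ 2 ^ (N + 1) * (2 - √2)
      + 2 ^ (N + 1) * (√2 - 1) / (2 * κ * (2 + √2) ^ N) * (κ * groupCostRatio j * 2 ^ j) := by
  obtain ⟨hl, hu⟩ := sqrt_two_bounds
  rcases j with _ | j
  · have : (1 : ℝ) ≤ 2 ^ N := one_le_pow₀ (by norm_num)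
    rw [groupCostRatio_zero, pow_succ]
    nlinarith
  have e : 2 ^ (N + 1) * (√2 - 1) / (2 * κ * (2 + √2) ^ N) * (κ * groupCostRatio (j + 1) * 2 ^ (j + 1))
      = 2 ^ (N + 1) * ((√2 - 1) * ((2 + √2) ^ j / (2 + √2) ^ N)) := by
    rw [← groupCostRatio_succ_mul_two_pow j]
    field_simp
    ring
  rw [e]
  -- Below the chord's endpoints the intercept alone suffices, since `2 * (2 - √2) > 1`; from there
  -- on the claim is `two_pow_le_affine` scaled by `2 ^ (N + 1)`.
  rcases lt_or_ge j N with h | h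
  · have h1 : (2 : ℝ) ^ (j + 1) ≤ 2 ^ N := pow_le_pow_right₀ (by norm_num) h
    have h2 : 0 ≤ 2 ^ (N + 1) * ((√2 - 1) * ((2 + √2) ^ j / (2 + √2) ^ N)) := by
      have : 0 ≤ √2 - 1 := by linarith
      positivity
    have h3 : 0 ≤ (2 : ℝ) ^ N * (2 * (2 - √2) - 1) := mul_nonneg (by positivity) (by linarith)
    rw [show (2 : ℝ) ^ (N + 1) * (2 - √2) = 2 ^ N * (2 * (2 - √2) - 1) + 2 ^ N by ring]
    linarith
  · obtain ⟨d, rfl⟩ := Nat.exists_eq_add_of_le h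
    have : (2 + √2) ^ (N + d) / (2 + √2) ^ N = (2 + √2) ^ d := by
      rw [pow_add]; field_simp
    rw [this, ← mul_add, show N + d + 1 = N + 1 + d by ring, pow_add (2 : ℝ) (N + 1) d]
    exact mul_le_mul_of_nonneg_left (two_pow_le_affine d) (by positivity)

/-! ### Lower bounds on the optimum -/

namespace Market

lemma bddAbove_opt (I : Market) (B : ℝ≥0) :
    BddAbove {v : ℝ | ∃ x : Fin I.n → ℝ, (∀ i, 0 ≤ x i ∧ x i ≤ 1) ∧
      ∑ i, x i * (I.c i : ℝ) ≤ (B : ℝ) ∧ v = ∑ i, x i * (I.u i : ℝ)} := by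
  refine ⟨∑ i, (I.u i : ℝ), ?_⟩
  rintro v ⟨x, hx, -, rfl⟩
  exact Finset.sum_le_sum fun i _ => mul_le_of_le_one_left (I.u i).2 (hx i).2

lemma le_opt (I : Market) {B : ℝ≥0} {x : Fin I.n → ℝ} (hx : ∀ i, 0 ≤ x i ∧ x i ≤ 1)
    (hB : ∑ i, x i * (I.c i : ℝ) ≤ (B : ℝ)) : ∑ i, x i * (I.u i : ℝ) ≤ I.opt B :=
  le_csSup (I.bddAbove_opt B) ⟨x, hx, hB, rfl⟩

lemma opt_nonneg (I : Market) (B : ℝ≥0) : 0 ≤ I.opt B := by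
  simpa using I.le_opt (B := B) (x := fun _ => 0) (by simp) (by simp)

lemma opt_mono (I : Market) : Monotone I.opt := by
  intro B B' h
  refine csSup_le_csSup (I.bddAbove_opt B') ⟨0, fun _ => 0, by simp, by simp, by simp⟩ ?_
  rintro v ⟨x, hx, hB, rfl⟩
  exact ⟨x, hx, hB.trans (by exact_mod_cast h), rfl⟩

lemma coe_c_eq (I : Market) (i : Fin I.n) : (I.c i : ℝ) = I.γ i * I.u i := by
  rw [Market.γ, NNReal.coe_div, div_mul_cancel₀]
  exact_mod_cast (I.u_pos i).ne'

/-- A group-wise fractional purchase that is affordable in the exactly geometric market is a lower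
bound for the optimum of a nearly geometric market, up to the error of the group utilities. -/
lemma opt_ge_of_group (I : Market) {m : ℕ} {κ η : ℝ} (hκ : 0 ≤ κ) (hη : 0 ≤ η)
    {k : Fin I.n → Fin (m + 1)} (hγ : ∀ i, (I.γ i : ℝ) = κ * groupCostRatio (k i))
    (hk : ∀ j : Fin (m + 1),
      |∑ i ∈ Finset.univ.filter (fun i => k i = j), (I.u i : ℝ) - groupUtility j| ≤ η)
    {B : ℝ≥0} {y : ℕ → ℝ} (hy : ∀ j, 0 ≤ y j ∧ y j ≤ 1)
    (hB : κ * ∑ j ∈ Finset.range (m + 1), y j * (groupCostRatio j * groupUtility j) ≤ B) :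
    (1 - η) / (1 + η) * ∑ j ∈ Finset.range (m + 1), y j * groupUtility j ≤ I.opt B := by
  have hη1 : 0 < 1 + η := by linarith
  set G : Fin (m + 1) → ℝ := fun j => ∑ i ∈ Finset.univ.filter (fun i => k i = j), (I.u i : ℝ)
    with hG
  -- Group utilities are at least `1`, so the absolute error `η` is also a relative error.
  have hGu : ∀ j : Fin (m + 1), G j ≤ (1 + η) * groupUtility j := fun j => by
    have := (abs_le.1 (hk j)).2
    have := mul_le_mul_of_nonneg_left (one_le_groupUtility j) hη
    simp only [hG]; linarith
  have hGl : ∀ j : Fin (m + 1), (1 - η) * groupUtility j ≤ G j := fun j => by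
    have := (abs_le.1 (hk j)).1
    have := mul_le_mul_of_nonneg_left (one_le_groupUtility j) hη
    simp only [hG]; linarith
  have hfib : ∀ f : Fin (m + 1) → ℝ, ∑ i, f (k i) * (I.u i : ℝ) = ∑ j, f j * G j := by
    intro f
    rw [← Finset.sum_fiberwise Finset.univ k]
    refine Finset.sum_congr rfl fun j _ => ?_
    rw [hG, Finset.mul_sum]
    refine Finset.sum_congr rfl fun i hi => ?_
    rw [(Finset.mem_filter.1 hi).2]
  have hfeas : ∑ i, y (k i) / (1 + η) * (I.c i : ℝ) ≤ B := by
    refine le_trans ?_ hB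
    have : ∀ i, y (k i) / (1 + η) * (I.c i : ℝ)
        = (y (k i) / (1 + η) * (κ * groupCostRatio (k i))) * (I.u i : ℝ) := fun i => by
      rw [I.coe_c_eq, hγ]; ring
    simp_rw [this]
    rw [hfib fun j => y j / (1 + η) * (κ * groupCostRatio j), Finset.sum_range, Finset.mul_sum]
    refine Finset.sum_le_sum fun j _ => ?_
    have h0 : 0 ≤ y j / (1 + η) * (κ * groupCostRatio j) :=
      mul_nonneg (div_nonneg (hy j).1 hη1.le) (mul_nonneg hκ (groupCostRatio_nonneg j))
    refine (mul_le_mul_of_nonneg_left (hGu j) h0).trans_eq ?_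
    field_simp
  refine le_trans ?_ (I.le_opt (x := fun i => y (k i) / (1 + η)) (fun i => ⟨?_, ?_⟩) hfeas)
  · rw [hfib fun j => y j / (1 + η), Finset.sum_range, Finset.mul_sum]
    refine Finset.sum_le_sum fun j _ => ?_
    refine le_trans (le_of_eq ?_)
      (mul_le_mul_of_nonneg_left (hGl j) (div_nonneg (hy j).1 hη1.le))
    ring
  · exact div_nonneg (hy _).1 hη1.le
  · rw [div_le_one hη1]; linarith [(hy (k i)).2]

end Market

lemma sum_range_threshold {c y : ℕ → ℝ} {k m : ℕ} (hm : k + 2 ≤ m) (h1 : ∀ j ≤ k, y j = 1)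
    (h0 : ∀ j, k + 2 < j → y j = 0) :
    ∑ j ∈ Finset.range (m + 1), y j * c j
      = ∑ j ∈ Finset.range (k + 1), c j + y (k + 1) * c (k + 1) + y (k + 2) * c (k + 2) := by
  rw [← Finset.sum_subset (s₁ := Finset.range (k + 3)), Finset.sum_range_succ,
    Finset.sum_range_succ]
  · congr 2
    refine Finset.sum_congr rfl fun j hj => ?_
    rw [h1 j (by simp at hj; omega), one_mul]
  · intro j; simp; omega
  · intro j _ hj
    rw [h0 j (by simp at hj; omega), zero_mul]

/-- The optimum of a nearly geometric market exceeds the best posted-price outcome by the factor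
`4 - 2√2`. -/
lemma Market.line_le_opt (I : Market) {m N : ℕ} {κ η : ℝ} (hκ : 0 < κ) (hη : 0 ≤ η)
    (hm : N + 3 ≤ m)
    {k : Fin I.n → Fin (m + 1)} (hγ : ∀ i, (I.γ i : ℝ) = κ * groupCostRatio (k i))
    (hk : ∀ j : Fin (m + 1),
      |∑ i ∈ Finset.univ.filter (fun i => k i = j), (I.u i : ℝ) - groupUtility j| ≤ η)
    {B : ℝ≥0} (hB₁ : 2 * κ * (2 + √2) ^ N ≤ B) (hB₂ : B ≤ 2 * κ * (2 + √2) ^ (N + 1)) :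
    (1 - η) / (1 + η) * ((4 - 2 * √2) * (2 ^ (N + 1) * (2 - √2)
      + 2 ^ (N + 1) * (√2 - 1) / (2 * κ * (2 + √2) ^ N) * B)) ≤ I.opt B := by
  obtain ⟨hl, hu⟩ := sqrt_two_bounds
  have hs := sq_sqrt_two
  have hS : 0 < 2 * κ * (2 + √2) ^ N := by positivity
  -- `lam` is the position of `B` between the costs of posted prices `N + 1` and `N + 2`, whose
  -- ratio is `1 + (1 + √2)`.
  obtain ⟨lam, hlam⟩ : ∃ lam : ℝ, (B : ℝ) = 2 * κ * (2 + √2) ^ N * (1 + lam * (1 + √2)) :=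
    ⟨((B : ℝ) / (2 * κ * (2 + √2) ^ N) - 1) / (1 + √2), by field_simp; ring⟩
  have hlam0 : 0 ≤ lam := by
    rw [hlam] at hB₁
    have := le_of_mul_le_mul_left ((mul_one _).trans_le hB₁) hS
    by_contra hneg
    nlinarith
  have hlam1 : lam ≤ 1 := by
    rw [hlam, pow_succ, ← mul_assoc] at hB₂
    have := le_of_mul_le_mul_left hB₂ hS
    by_contra hneg
    nlinarith
  -- The convex combination, with weights `1 - lam` and `lam`, of the purchases for the two end
  -- budgets: each buys the groups covered by its posted price and a fraction `3 - 2√2` of the next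
  -- group.
  set y : ℕ → ℝ := fun j => if j ≤ N + 1 then 1 else if j = N + 2 then
    (1 - lam) * (3 - 2 * √2) + lam else if j = N + 3 then lam * (3 - 2 * √2) else 0 with hy
  have y1 : ∀ j ≤ N + 1, y j = 1 := fun j hj => by simp [hy, hj]
  have y2 : y (N + 1 + 1) = (1 - lam) * (3 - 2 * √2) + lam := by simp [hy]
  have y3 : y (N + 1 + 2) = lam * (3 - 2 * √2) := by simp [hy]
  have y0 : ∀ j, N + 1 + 2 < j → y j = 0 := fun j hj => by
    simp only [hy]
    rw [if_neg (by omega), if_neg (by omega), if_neg (by omega)]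
  have hval : ∑ j ∈ Finset.range (m + 1), y j * groupUtility j
      = (4 - 2 * √2) * (2 ^ (N + 1) * (1 + lam)) := by
    rw [sum_range_threshold (k := N + 1) (by omega) y1 y0, sum_groupUtility, y2, y3,
      groupUtility_succ, groupUtility_succ, pow_succ (2 : ℝ) (N + 1)]
    ring
  have hcost : κ * ∑ j ∈ Finset.range (m + 1), y j * (groupCostRatio j * groupUtility j) ≤ B := by
    rw [sum_range_threshold (k := N + 1) (by omega) y1 y0, sum_groupCostRatio_mul_groupUtility,
      y2, y3, groupUtility_succ, groupUtility_succ, groupCostRatio_succ_mul_two_pow,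
      groupCostRatio_succ_mul_two_pow, hlam, pow_succ _ (N + 1), pow_succ _ N]
    have : 2 * κ * (2 + √2) ^ N * (1 + lam * (1 + √2)) = κ * ((√2 - 1) * ((2 + √2) ^ N * (2 + √2)) +
        ((1 - lam) * (3 - 2 * √2) + lam) * ((2 + √2) ^ N * (2 + √2)) +
        lam * (3 - 2 * √2) * ((2 + √2) ^ N * (2 + √2) * (2 + √2))) := by
      linear_combination (κ * (2 + √2) ^ N * (1 + 3 * lam + 2 * lam * √2)) * hs
    rw [this]
    refine mul_le_mul_of_nonneg_left ?_ hκ.le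
    nlinarith
  have h := I.opt_ge_of_group hκ.le hη hγ hk (y := y) (fun j => ?_) hcost
  · rw [hval] at h
    convert h using 3
    rw [hlam]
    field_simp
    linear_combination lam * hs
  · simp only [hy]
    split_ifs
    · simp
    · constructor <;> nlinarith
    · constructor <;> nlinarith
    · simp

/-! ### Independent types -/

section Sampling

variable {n : ℕ} {T : Type*}

/-- The probability of the profile `s` when the types are independent with distribution `q`. -/
def profileWeight (q : T → ℝ) (s : Fin n → T) : ℝ := ∏ i, q (s i)

lemma profileWeight_nonneg {q : T → ℝ} (hq : ∀ t, 0 ≤ q t) (s : Fin n → T) :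
    0 ≤ profileWeight q s := Finset.prod_nonneg fun _ _ => hq _

lemma profileWeight_update (q : T → ℝ) (s : Fin n → T) (i : Fin n) (t : T) :
    profileWeight q (Function.update s i t) * q (s i) = profileWeight q s * q t := by
  classical
  have h : ∀ s : Fin n → T, profileWeight q s = q (s i) * ∏ k ∈ Finset.univ.erase i, q (s k) :=
    fun s => (Finset.mul_prod_erase _ _ (Finset.mem_univ i)).symm
  rw [h, h s, Function.update_self]
  have : ∏ k ∈ Finset.univ.erase i, q (Function.update s i t k)
      = ∏ k ∈ Finset.univ.erase i, q (s k) :=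
    Finset.prod_congr rfl fun k hk => by rw [Function.update_of_ne (Finset.ne_of_mem_erase hk)]
  rw [this]; ring

variable [Fintype T]

lemma sum_profileWeight {q : T → ℝ} (hq : ∑ t, q t = 1) :
    ∑ s : Fin n → T, profileWeight q s = 1 := by
  classical
  have := Finset.prod_univ_sum (fun _ : Fin n => (Finset.univ : Finset T)) (fun _ t => q t)
  simp only [hq, Finset.prod_const_one, Fintype.piFinset_univ] at this
  exact this.symm

/-- Resampling the type of one seller does not change expectations. -/
lemma sum_profileWeight_mul_eq_resample {q : T → ℝ} (hq : ∑ t, q t = 1) (i : Fin n)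
    (F : (Fin n → T) → ℝ) :
    ∑ s, profileWeight q s * F s
      = ∑ t, q t * ∑ s, profileWeight q s * F (Function.update s i t) := by
  have h1 : ∑ s, profileWeight q s * F s
      = ∑ x : (Fin n → T) × T, profileWeight q x.1 * q x.2 * F x.1 := by
    rw [Fintype.sum_prod_type]
    refine Finset.sum_congr rfl fun s _ => ?_
    simp only
    rw [← Finset.sum_mul, ← Finset.mul_sum, hq, mul_one]
  have h2 : ∑ t, q t * ∑ s, profileWeight q s * F (Function.update s i t)
      = ∑ x : (Fin n → T) × T, profileWeight q x.1 * q x.2 * F (Function.update x.1 i x.2) := by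
    rw [Fintype.sum_prod_type, Finset.sum_comm]
    refine Finset.sum_congr rfl fun t _ => ?_
    rw [Finset.mul_sum]
    exact Finset.sum_congr rfl fun s _ => by ring
  rw [h1, h2]
  -- Swapping the fresh type with the type of seller `i` is an involution preserving the product
  -- weight.
  have hinv : Function.Involutive
      fun x : (Fin n → T) × T => (Function.update x.1 i x.2, x.1 i) := by
    rintro ⟨s, t⟩
    simp
  refine Fintype.sum_equiv hinv.toPerm _ _ fun x => ?_
  simp only [Function.Involutive.coe_toPerm, Function.update_idem, Function.update_eq_self]
  rw [profileWeight_update]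

/-- Variances of independent variables add: resampling coordinate `i` kills the cross terms because
`f` has mean zero. -/
lemma sum_profileWeight_mul_sq {q : T → ℝ} (hq : ∑ t, q t = 1) {f : T → ℝ}
    (hf : ∑ t, q t * f t = 0) :
    ∑ s : Fin n → T, profileWeight q s * (∑ i, f (s i)) ^ 2 = n * ∑ t, q t * f t ^ 2 := by
  have hpair : ∀ i k : Fin n, ∑ s : Fin n → T, profileWeight q s * (f (s i) * f (s k))
      = if i = k then ∑ t, q t * f t ^ 2 else 0 := by
    intro i k
    rw [sum_profileWeight_mul_eq_resample hq i]
    split_ifs with h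
    · subst h
      simp only [Function.update_self, ← Finset.sum_mul, sum_profileWeight hq]
      exact Finset.sum_congr rfl fun t _ => by ring
    · simp only [Function.update_self, Function.update_of_ne (Ne.symm h)]
      have : ∀ t, q t * ∑ s : Fin n → T, profileWeight q s * (f t * f (s k))
          = q t * f t * ∑ s : Fin n → T, profileWeight q s * f (s k) := fun t => by
        rw [mul_assoc, Finset.mul_sum (a := f t)]
        congr 1
        exact Finset.sum_congr rfl fun s _ => by ring
      simp_rw [this, ← Finset.sum_mul, hf, zero_mul]
  simp_rw [sq (∑ i, f _), Finset.sum_mul_sum, Finset.mul_sum]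
  rw [Finset.sum_comm]
  simp_rw [Finset.sum_comm (γ := Fin n → T), hpair]
  simp [Finset.mul_sum]

/-- Chebyshev's inequality for the number of sellers of each type. -/
lemma sum_profileWeight_deviation_le [DecidableEq T] {q : T → ℝ} (hq0 : ∀ t, 0 ≤ q t)
    (hq : ∑ t, q t = 1) {v η : ℝ} (hη : 0 < η) :
    ∑ s ∈ Finset.univ.filter (fun s : Fin n → T =>
        ¬ ∀ j, |∑ _i ∈ Finset.univ.filter (fun i => s i = j), v - v * n * q j| ≤ η),
      profileWeight q s ≤ Fintype.card T * (v / η) ^ 2 * n := by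
  set f : T → T → ℝ := fun j t => (if t = j then 1 else 0) - q j with hf
  have hdev : ∀ (s : Fin n → T) j,
      ∑ _i ∈ Finset.univ.filter (fun i => s i = j), v - v * n * q j = v * ∑ i, f j (s i) := by
    intro s j
    simp only [hf, Finset.sum_sub_distrib, Finset.sum_boole, Finset.sum_const, Finset.card_univ,
      Fintype.card_fin, nsmul_eq_mul]
    ring
  have hq1 : ∀ j, q j ≤ 1 := fun j => hq ▸
    Finset.single_le_sum (f := q) (fun t _ => hq0 t) (Finset.mem_univ j)
  have hmean : ∀ j, ∑ t, q t * f j t = 0 := fun j => by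
    simp only [hf, mul_sub, Finset.sum_sub_distrib, ← Finset.sum_mul, hq]
    simp
  have hvar : ∀ j, ∑ t, q t * f j t ^ 2 ≤ 1 := fun j => by
    rw [← hq]
    refine Finset.sum_le_sum fun t _ => mul_le_of_le_one_right (hq0 t) ?_
    simp only [hf]
    have := hq0 j
    have := hq1 j
    split_ifs <;> nlinarith
  -- Markov and union bound together: on a bad profile some type `j` has normalized squared
  -- deviation at least `1`.
  calc _ ≤ ∑ s ∈ Finset.univ.filter (fun s : Fin n → T =>
        ¬ ∀ j, |∑ _i ∈ Finset.univ.filter (fun i => s i = j), v - v * n * q j| ≤ η),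
      ∑ j, (v / η) ^ 2 * (profileWeight q s * (∑ i, f j (s i)) ^ 2) := by
        refine Finset.sum_le_sum fun s hs => ?_
        have hs := (Finset.mem_filter.1 hs).2
        push Not at hs
        obtain ⟨j, hj⟩ := hs
        rw [hdev] at hj
        have h0 : ∀ j, 0 ≤ (v / η) ^ 2 * (profileWeight q s * (∑ i, f j (s i)) ^ 2) := fun j =>
          mul_nonneg (sq_nonneg _) (mul_nonneg (profileWeight_nonneg hq0 s) (sq_nonneg _))
        refine le_trans ?_ (Finset.single_le_sum (fun j _ => h0 j) (Finset.mem_univ j))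
        have h1 : 1 ≤ (v * ∑ i, f j (s i)) ^ 2 / η ^ 2 := by
          rw [one_le_div (by positivity), ← sq_abs (v * _)]
          exact pow_le_pow_left₀ hη.le hj.le 2
        calc profileWeight q s = profileWeight q s * 1 := (mul_one _).symm
          _ ≤ profileWeight q s * ((v * ∑ i, f j (s i)) ^ 2 / η ^ 2) :=
            mul_le_mul_of_nonneg_left h1 (profileWeight_nonneg hq0 s)
          _ = _ := by ring
    _ ≤ ∑ s : Fin n → T, ∑ j, (v / η) ^ 2 * (profileWeight q s * (∑ i, f j (s i)) ^ 2) :=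
        Finset.sum_le_sum_of_subset_of_nonneg (Finset.filter_subset _ _) fun s _ _ =>
          Finset.sum_nonneg fun j _ =>
            mul_nonneg (sq_nonneg _) (mul_nonneg (profileWeight_nonneg hq0 s) (sq_nonneg _))
    _ = ∑ j, (v / η) ^ 2 * (n * ∑ t, q t * f j t ^ 2) := by
        rw [Finset.sum_comm]
        refine Finset.sum_congr rfl fun j _ => ?_
        rw [← Finset.mul_sum, sum_profileWeight_mul_sq hq (hmean j)]
    _ ≤ ∑ _j : T, (v / η) ^ 2 * (n * 1) := by
        refine Finset.sum_le_sum fun j _ => ?_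
        gcongr
        exact hvar j
    _ = _ := by simp; ring

lemma one_sub_le_sum_profileWeight [DecidableEq T] {q : T → ℝ} (hq0 : ∀ t, 0 ≤ q t)
    (hq : ∑ t, q t = 1) {v η : ℝ} (hη : 0 < η) :
    1 - Fintype.card T * (v / η) ^ 2 * n ≤ ∑ s ∈ Finset.univ.filter (fun s : Fin n → T =>
        ∀ j, |∑ _i ∈ Finset.univ.filter (fun i => s i = j), v - v * n * q j| ≤ η),
      profileWeight q s := by
  have h := sum_profileWeight_deviation_le (n := n) hq0 hq (v := v) hη
  rw [← sum_profileWeight (n := n) hq, ← Finset.sum_filter_add_sum_filter_not Finset.univ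
    (fun s : Fin n → T =>
      ∀ j, |∑ _i ∈ Finset.univ.filter (fun i => s i = j), v - v * n * q j| ≤ η)]
  linarith

end Sampling

/-- The distribution of the group of a seller in the geometric market. -/
noncomputable def groupProb (m : ℕ) (j : Fin (m + 1)) : ℝ := groupUtility j / 2 ^ m

lemma groupProb_nonneg {m : ℕ} (j : Fin (m + 1)) : 0 ≤ groupProb m j :=
  div_nonneg (zero_le_one.trans (one_le_groupUtility j)) (by positivity)

lemma sum_groupProb (m : ℕ) : ∑ j, groupProb m j = 1 := by
  simp only [groupProb]
  rw [← Finset.sum_div, ← Finset.sum_range (fun j => groupUtility j), sum_groupUtility,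
    div_self (by positivity)]

/-! ### Expected allocations and payments -/

namespace RandomizedMechanism

variable {Ω : Type*} [MeasurableSpace Ω]

instance (M : RandomizedMechanism Ω) : IsProbabilityMeasure M.P := M.isProb

lemma expAlloc_nonneg (M : RandomizedMechanism Ω) (n : ℕ) (u : Fin n → ℝ≥0) (B : ℝ≥0)
    (γ : Fin n → ℝ≥0) (i : Fin n) : 0 ≤ M.expAlloc n u B γ i :=
  integral_nonneg fun _ => NNReal.coe_nonneg _

lemma expAlloc_le_one (M : RandomizedMechanism Ω) (n : ℕ) (u : Fin n → ℝ≥0) (B : ℝ≥0)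
    (γ : Fin n → ℝ≥0) (i : Fin n) : M.expAlloc n u B γ i ≤ 1 := by
  have h : ∀ ω, ((M.det ω).alloc n u B γ i : ℝ) ≤ 1 := fun ω => by
    exact_mod_cast (M.det ω).alloc_le_one n u B γ i
  refine (integral_mono_of_nonneg (.of_forall fun _ => NNReal.coe_nonneg _)
    (integrable_const (1 : ℝ)) (.of_forall h)).trans (by simp)

lemma measurable_expAlloc (M : RandomizedMechanism Ω) (n : ℕ) (u : Fin n → ℝ≥0)
    (γ : Fin n → ℝ≥0) (i : Fin n) : Measurable fun B => M.expAlloc n u B γ i :=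
  ((M.measurable_alloc n u γ i).coe_nnreal_real.stronglyMeasurable.integral_prod_right'
    (ν := M.P)).measurable

lemma BudgetFeasible.sum_expPay_le {M : RandomizedMechanism Ω} (hBF : M.BudgetFeasible) {n : ℕ}
    {u : Fin n → ℝ≥0} (hu : ∀ i, 0 < u i) {B : ℝ≥0} (hB : 0 < B) (γ : Fin n → ℝ≥0) :
    ∑ i, M.expPay n u B γ i * (u i : ℝ) ≤ B := by
  have hae := hBF n u hu B hB γ
  -- The almost sure budget bound makes payments integrable; otherwise their Bochner integral would
  -- default to `0`.
  have hint : ∀ i, Integrable (fun ω => ((M.det ω).pay n u B γ i : ℝ) * u i) M.P := by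
    intro i
    refine (integrable_const (B : ℝ)).mono' ?_ ?_
    · exact (((M.measurable_pay n u γ i).comp
        measurable_prodMk_left).coe_nnreal_real.mul_const _).aestronglyMeasurable
    · filter_upwards [hae] with ω hω
      rw [Real.norm_of_nonneg (by positivity)]
      exact_mod_cast (Finset.single_le_sum (f := fun i => (M.det ω).pay n u B γ i * u i)
        (fun _ _ => zero_le) (Finset.mem_univ i)).trans hω
  calc ∑ i, M.expPay n u B γ i * (u i : ℝ)
      = ∫ ω, ∑ i, ((M.det ω).pay n u B γ i : ℝ) * u i ∂M.P := by
        rw [integral_finsetSum _ fun i _ => hint i]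
        simp_rw [integral_mul_const]
        rfl
    _ ≤ ∫ _, (B : ℝ) ∂M.P := by
        refine integral_mono_ae (integrable_finsetSum _ fun i _ => hint i) (integrable_const _) ?_
        filter_upwards [hae] with ω hω
        exact_mod_cast hω
    _ = B := by simp

/-- By individual rationality the expected allocation costs at most the expected payments, so it is
itself a feasible fractional purchase. -/
lemma sum_expAlloc_le_opt {M : RandomizedMechanism Ω} (hIR : M.IndividuallyRational)
    (hBF : M.BudgetFeasible) (I : Market) {B : ℝ≥0} (hB : 0 < B) :
    ∑ i, M.expAlloc I.n I.u B I.γ i * (I.u i : ℝ) ≤ I.opt B := by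
  refine I.le_opt (fun i => ⟨M.expAlloc_nonneg _ _ _ _ _, M.expAlloc_le_one _ _ _ _ _⟩) ?_
  refine le_trans (Finset.sum_le_sum fun i _ => ?_) (hBF.sum_expPay_le I.u_pos hB I.γ)
  rw [I.coe_c_eq]
  exact hIR I.n I.u I.u_pos B hB I.γ i

lemma competitiveRatio_nonneg (M : RandomizedMechanism Ω) (I : Market) (B : ℝ≥0) :
    0 ≤ M.competitiveRatio I B :=
  div_nonneg (Finset.sum_nonneg fun _ _ =>
    mul_nonneg (M.expAlloc_nonneg _ _ _ _ _) (NNReal.coe_nonneg _)) (I.opt_nonneg B)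

lemma competitiveRatio_le_one {M : RandomizedMechanism Ω} (hIR : M.IndividuallyRational)
    (hBF : M.BudgetFeasible) (I : Market) {B : ℝ≥0} (hB : 0 < B) :
    M.competitiveRatio I B ≤ 1 :=
  div_le_one_of_le₀ (sum_expAlloc_le_opt hIR hBF I hB) (I.opt_nonneg B)

lemma measurable_competitiveRatio (M : RandomizedMechanism Ω) (I : Market) :
    Measurable (M.competitiveRatio I) :=
  (Finset.measurable_sum _ fun i _ => (M.measurable_expAlloc _ _ _ i).mul_const _).div
    I.opt_mono.measurable

lemma integrable_competitiveRatio {M : RandomizedMechanism Ω} (hIR : M.IndividuallyRational)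
    (hBF : M.BudgetFeasible) (I : Market) {D : Measure ℝ≥0} [IsProbabilityMeasure D]
    (hD : ∀ᵐ ρ ∂D, 0 < ρ) {B₀ : ℝ≥0} (hB₀ : 0 < B₀) :
    Integrable (fun ρ => M.competitiveRatio I (ρ * B₀)) D := by
  refine (integrable_const (1 : ℝ)).mono'
    ((M.measurable_competitiveRatio I).comp (measurable_id.mul_const B₀)).aestronglyMeasurable ?_
  filter_upwards [hD] with ρ hρ
  rw [Real.norm_of_nonneg (M.competitiveRatio_nonneg _ _)]
  exact competitiveRatio_le_one hIR hBF I (mul_pos hρ hB₀)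

/-! ### Interim allocations and payments -/

lemma TruthfulInExpectation.expPay_sub_le {M : RandomizedMechanism Ω}
    (hT : M.TruthfulInExpectation) {n : ℕ} {u : Fin n → ℝ≥0} (hu : ∀ i, 0 < u i) {B : ℝ≥0}
    (hB : 0 < B) (γ : Fin n → ℝ≥0) (i : Fin n) (z z' : ℝ≥0) :
    M.expPay n u B (Function.update γ i z') i - z * M.expAlloc n u B (Function.update γ i z') i
      ≤ M.expPay n u B (Function.update γ i z) i
        - z * M.expAlloc n u B (Function.update γ i z) i := by
  have h := hT n u hu B hB (Function.update γ i z) i z'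
  rw [Function.update_idem, Function.update_self] at h
  have hui : (0 : ℝ) < u i := by exact_mod_cast hu i
  refine le_of_mul_le_mul_right ?_ hui
  linarith

lemma IndividuallyRational.mul_expAlloc_le {M : RandomizedMechanism Ω}
    (hIR : M.IndividuallyRational) {n : ℕ} {u : Fin n → ℝ≥0} (hu : ∀ i, 0 < u i) {B : ℝ≥0}
    (hB : 0 < B) (γ : Fin n → ℝ≥0) (i : Fin n) (z : ℝ≥0) :
    z * M.expAlloc n u B (Function.update γ i z) i
      ≤ M.expPay n u B (Function.update γ i z) i := by
  have h := hIR n u hu B hB (Function.update γ i z) i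
  rw [Function.update_self] at h
  have hui : (0 : ℝ) < u i := by exact_mod_cast hu i
  refine le_of_mul_le_mul_right ?_ hui
  linarith

/-- If the cost-per-utility of `n` sellers of utility `v` are drawn independently from the
geometric distribution, the expected total utility is bounded by every affine function lying above
all posted-price outcomes. -/
lemma sum_profileWeight_expAlloc_le {M : RandomizedMechanism Ω} (hT : M.TruthfulInExpectation)
    (hIR : M.IndividuallyRational) (hBF : M.BudgetFeasible) {n m : ℕ} (hn : 0 < n) {v : ℝ≥0}
    (hv : 0 < v) (hvn : (v : ℝ) * n = 2 ^ m) {B : ℝ≥0} (hB : 0 < B) {γ : ℕ → ℝ≥0}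
    (hγ : StrictMono γ) {a b : ℝ} (ha : 0 ≤ a) (hb : 0 ≤ b)
    (hab : ∀ j, 2 ^ j ≤ a + b * (γ j * 2 ^ j)) :
    ∑ s : Fin n → Fin (m + 1), profileWeight (groupProb m) s *
      ∑ i, M.expAlloc n (fun _ => v) B (fun i => γ (s i)) i * v ≤ a + b * B := by
  have hq0 := groupProb_nonneg (m := m)
  have hq1 := sum_groupProb m
  have hn' : (0 : ℝ) < n := by exact_mod_cast hn
  have hu : ∀ _ : Fin n, 0 < v := fun _ => hv
  -- the average over all sellers of an expectation conditional on the own report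
  set avg : ((Fin n → ℝ≥0) → Fin n → ℝ) → ℝ≥0 → ℝ := fun h z =>
    (∑ i, ∑ s : Fin n → Fin (m + 1),
      profileWeight (groupProb m) s * h (Function.update (fun k => γ (s k)) i z) i) / n with havg
  have avg_le : ∀ (h h' : (Fin n → ℝ≥0) → Fin n → ℝ) (z z' : ℝ≥0),
      (∀ γ' i, h (Function.update γ' i z) i ≤ h' (Function.update γ' i z') i) →
      avg h z ≤ avg h' z' := by
    intro h h' z z' hh
    refine div_le_div_of_nonneg_right (Finset.sum_le_sum fun i _ => Finset.sum_le_sum fun s _ =>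
      mul_le_mul_of_nonneg_left (hh _ _) (profileWeight_nonneg hq0 s)) hn'.le
  have avg_lin : ∀ (h h' : (Fin n → ℝ≥0) → Fin n → ℝ) (c : ℝ) (z : ℝ≥0),
      avg (fun g i => h g i - c * h' g i) z = avg h z - c * avg h' z := by
    intro h h' c z
    simp only [havg, mul_sub, Finset.sum_sub_distrib, sub_div]
    congr 1
    rw [mul_div_assoc', Finset.mul_sum]
    simp only [Finset.mul_sum]
    congr 1
    exact Finset.sum_congr rfl fun i _ => Finset.sum_congr rfl fun s _ => by ring
  -- By resampling, a seller's own type may be drawn separately from the profile; the weights match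
  -- since `groupUtility j = 2 ^ m * groupProb m j` and `v = 2 ^ m / n`.
  have avg_total : ∀ h : (Fin n → ℝ≥0) → Fin n → ℝ,
      ∑ j ∈ Finset.range (m + 1), groupUtility j * avg h (γ j)
        = ∑ s : Fin n → Fin (m + 1), profileWeight (groupProb m) s * ∑ i, h (fun k => γ (s k)) i * v := by
    intro h
    have hres : ∀ i : Fin n, ∑ s : Fin n → Fin (m + 1), profileWeight (groupProb m) s * h (fun k => γ (s k)) i
        = ∑ t : Fin (m + 1), groupProb m t * ∑ s : Fin n → Fin (m + 1),
          profileWeight (groupProb m) s * h (Function.update (fun k => γ (s k)) i (γ t)) i := by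
      intro i
      rw [sum_profileWeight_mul_eq_resample hq1 i]
      have : ∀ (s : Fin n → Fin (m + 1)) (t : Fin (m + 1)),
          (fun k => γ (Function.update s i t k)) = Function.update (fun k => γ (s k)) i (γ t) :=
        fun s t => Function.comp_update (fun j : Fin (m + 1) => γ j) s i t
      simp only [this]
    have hv' : (v : ℝ) = 2 ^ m / n := by rw [← hvn]; field_simp
    calc _ = ∑ j : Fin (m + 1), groupUtility j * avg h (γ j) := Finset.sum_range _
      _ = ∑ t, v * ∑ i, (groupProb m t * ∑ s : Fin n → Fin (m + 1),
          profileWeight (groupProb m) s * h (Function.update (fun k => γ (s k)) i (γ t)) i) := by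
          refine Finset.sum_congr rfl fun t _ => ?_
          rw [← Finset.mul_sum, hv']
          simp only [havg, groupProb]
          field_simp
      _ = v * ∑ i, ∑ s : Fin n → Fin (m + 1), profileWeight (groupProb m) s * h (fun k => γ (s k)) i := by
          rw [← Finset.mul_sum, Finset.sum_comm]
          simp only [hres]
      _ = _ := by
          rw [Finset.sum_comm, Finset.mul_sum]
          refine Finset.sum_congr rfl fun s _ => ?_
          rw [← Finset.sum_mul, ← Finset.mul_sum]
          ring
  have avg_one : ∀ z, avg (fun _ _ => 1) z = 1 := fun z => by
    simp [havg, sum_profileWeight hq1, hn'.ne']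
  have avg_zero : ∀ z, avg (fun _ _ => 0) z = 0 := fun z => by simp [havg]
  clear_value avg
  set x := avg (M.expAlloc n (fun _ => v) B) with hx
  set p := avg (M.expPay n (fun _ => v) B) with hp
  have hIC : ∀ z z' : ℝ≥0, p z' - z * x z' ≤ p z - z * x z := by
    intro z z'
    rw [hx, hp, ← avg_lin, ← avg_lin]
    exact avg_le _ _ _ _ fun γ' i => hT.expPay_sub_le hu hB γ' i z z'
  have hIRz : ∀ z : ℝ≥0, z * x z ≤ p z := by
    intro z
    rw [← sub_nonneg, hx, hp, ← avg_lin, ← avg_zero z]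
    exact avg_le _ _ _ _ fun γ' i => sub_nonneg.2 (hIR.mul_expAlloc_le hu hB γ' i z)
  rw [← avg_total]
  refine sum_groupUtility_mul_le (x := fun j => x (γ j)) (p := fun j => p (γ j))
    (γ := fun j => γ j) (fun j _ => ?_) (hIRz _) (fun j _ => ?_) ?_ ?_ ?_ ha hb hab
  · linarith [hIC (γ j) (γ (j + 1))]
  -- Adding the two mutual incentive constraints cancels the payments and leaves monotonicity.
  · have h1 := hIC (γ j) (γ (j + 1))
    have h2 := hIC (γ (j + 1)) (γ j)
    have h3 : (γ j : ℝ) < γ (j + 1) := by exact_mod_cast hγ (Nat.lt_succ_self j)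
    by_contra hlt
    nlinarith
  · rw [← avg_zero (γ m)]
    exact avg_le _ _ _ _ fun _ _ => M.expAlloc_nonneg _ _ _ _ _
  · rw [← avg_one (γ 0)]
    exact avg_le _ _ _ _ fun _ _ => M.expAlloc_le_one _ _ _ _ _
  · rw [avg_total]
    calc _ ≤ ∑ s : Fin n → Fin (m + 1), profileWeight (groupProb m) s * B :=
          Finset.sum_le_sum fun s _ => mul_le_mul_of_nonneg_left
            (hBF.sum_expPay_le hu hB _) (profileWeight_nonneg hq0 s)
      _ = B := by rw [← Finset.sum_mul, sum_profileWeight hq1, one_mul]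

end RandomizedMechanism

/-! ### The hard market -/

/-- Continuity from below along the intervals `[1 / (k + 1), k + 1]`, which exhaust the positive
numbers. -/
lemma exists_measureReal_compl_Icc_lt (D : Measure ℝ≥0) [IsProbabilityMeasure D]
    (hD : ∀ᵐ ρ ∂D, 0 < ρ) {η : ℝ} (hη : 0 < η) :
    ∃ a b : ℝ≥0, 0 < a ∧ D.real (Set.Icc a b)ᶜ < η := by
  set S : ℕ → Set ℝ≥0 := fun k => Set.Icc (1 / ((k : ℝ≥0) + 1)) (k + 1) with hS
  have hmono : Monotone S := by
    intro k l h
    have hkl : (k : ℝ≥0) + 1 ≤ l + 1 := by exact_mod_cast Nat.succ_le_succ h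
    exact Set.Icc_subset_Icc (one_div_le_one_div_of_le (by positivity) hkl) hkl
  have hU : ⋃ k, S k = Set.Ioi 0 := by
    ext ρ
    simp only [Set.mem_iUnion, Set.mem_Ioi, hS, Set.mem_Icc]
    constructor
    · rintro ⟨k, h, -⟩
      exact lt_of_lt_of_le (by positivity) h
    · intro h
      obtain ⟨k, hk⟩ := exists_nat_ge (ρ + 1 / ρ)
      have h1 : ρ ≤ k := le_trans (le_add_of_nonneg_right zero_le) hk
      have h2 : 1 / ρ ≤ k := le_trans (le_add_of_nonneg_left zero_le) hk
      refine ⟨k, ?_, h1.trans (le_add_of_nonneg_right zero_le)⟩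
      rw [div_le_iff₀ (by positivity)]
      rw [div_le_iff₀ h] at h2
      rw [mul_add, mul_comm]
      exact h2.trans (le_add_of_nonneg_right zero_le)
  have h1 : D (⋃ k, S k) = 1 := by
    rw [hU]
    exact prob_compl_eq_zero_iff measurableSet_Ioi |>.1 (mem_ae_iff.1 hD)
  have hlim := tendsto_measure_iUnion_atTop (μ := D) hmono
  rw [h1] at hlim
  have hlim' := (ENNReal.tendsto_toReal ENNReal.one_ne_top).comp hlim
  obtain ⟨k, hk⟩ := (hlim'.eventually (lt_mem_nhds (show 1 - η < ENNReal.toReal 1 by simpa))).exists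
  refine ⟨1 / ((k : ℝ≥0) + 1), k + 1, by positivity, ?_⟩
  rw [probReal_compl_eq_one_sub measurableSet_Icc]
  have : 1 - η < D.real (S k) := hk
  linarith

/-- The costs-per-utility of the geometric groups with cost unit `κ`. -/
noncomputable def geometricCost (κ : ℝ≥0) (j : ℕ) : ℝ≥0 := κ * (groupCostRatio j).toNNReal

lemma coe_geometricCost (κ : ℝ≥0) (j : ℕ) : (geometricCost κ j : ℝ) = κ * groupCostRatio j := by
  rw [geometricCost, NNReal.coe_mul, Real.coe_toNNReal _ (groupCostRatio_nonneg j)]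

lemma geometricCost_strictMono {κ : ℝ≥0} (hκ : 0 < κ) : StrictMono (geometricCost κ) := by
  refine strictMono_nat_of_lt_succ fun j => ?_
  rw [← NNReal.coe_lt_coe, coe_geometricCost, coe_geometricCost]
  refine mul_lt_mul_of_pos_left ?_ (by exact_mod_cast hκ)
  rcases j with _ | j
  · simp [groupCostRatio_succ, groupCostRatio_zero]
  · rw [groupCostRatio_succ, groupCostRatio_succ]
    exact pow_lt_pow_right₀ (lt_add_of_pos_right _ (by positivity)) (Nat.lt_succ_self j)

/-- The market of `n` sellers of utility `v` and costs-per-utility `γ`. -/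
def equalUtilityMarket {n : ℕ} (hn : 0 < n) {v : ℝ≥0} (hv : 0 < v) (γ : Fin n → ℝ≥0) : Market where
  n := n
  n_pos := hn
  u := fun _ => v
  c := fun i => γ i * v
  u_pos := fun _ => hv

lemma equalUtilityMarket_γ {n : ℕ} (hn : 0 < n) {v : ℝ≥0} (hv : 0 < v) (γ : Fin n → ℝ≥0) :
    (equalUtilityMarket hn hv γ).γ = γ := by
  funext i
  exact mul_div_cancel_right₀ _ hv.ne'

namespace RandomizedMechanism

variable {Ω : Type*} [MeasurableSpace Ω]

/-- For a fixed budget, the average competitive ratio over the nearly geometric markets among the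
randomly sampled ones. -/
lemma sum_profileWeight_competitiveRatio_le {M : RandomizedMechanism Ω}
    (hT : M.TruthfulInExpectation) (hIR : M.IndividuallyRational) (hBF : M.BudgetFeasible)
    {n m N : ℕ} (hn : 0 < n) {v : ℝ≥0} (hv : 0 < v) (hvn : (v : ℝ) * n = 2 ^ m)
    {κ : ℝ≥0} (hκ : 0 < κ) {η : ℝ} (hη : 0 ≤ η) (hη1 : η < 1) (hm : N + 3 ≤ m)
    {G : Finset (Fin n → Fin (m + 1))}
    (hG : ∀ s ∈ G, ∀ j : Fin (m + 1),
      |∑ _i ∈ Finset.univ.filter (fun i => s i = j), (v : ℝ) - groupUtility j| ≤ η)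
    {B : ℝ≥0} (hB₁ : 2 * (κ : ℝ) * (2 + √2) ^ N ≤ B)
    (hB₂ : B ≤ 2 * (κ : ℝ) * (2 + √2) ^ (N + 1)) :
    ∑ s ∈ G, profileWeight (groupProb m) s *
        M.competitiveRatio (equalUtilityMarket hn hv fun i => geometricCost κ (s i)) B
      ≤ (2 + √2) / 4 * ((1 + η) / (1 - η)) := by
  obtain ⟨hl, hu⟩ := sqrt_two_bounds
  have hκ' : (0 : ℝ) < κ := by exact_mod_cast hκ
  have hB : 0 < B := by
    have : (0 : ℝ) < B := lt_of_lt_of_le (by positivity) hB₁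
    exact_mod_cast this
  set a : ℝ := 2 ^ (N + 1) * (2 - √2) with ha
  set b : ℝ := 2 ^ (N + 1) * (√2 - 1) / (2 * κ * (2 + √2) ^ N) with hb
  have ha0 : 0 < a := mul_pos (by positivity) (by linarith)
  have hb0 : 0 ≤ b := div_nonneg (mul_nonneg (by positivity) (by linarith)) (by positivity)
  have hL : 0 < a + b * B := by positivity
  set K : ℝ := (1 - η) / (1 + η) * ((4 - 2 * √2) * (a + b * B)) with hK
  have hK0 : 0 < K :=
    mul_pos (div_pos (by linarith) (by linarith)) (mul_pos (by linarith) hL)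
  have hsum := sum_profileWeight_expAlloc_le hT hIR hBF hn hv hvn hB
    (geometricCost_strictMono hκ) ha0.le hb0
    (fun j => by rw [coe_geometricCost]; exact two_pow_le_line hκ' N j)
  have hW : ∀ s : Fin n → Fin (m + 1), 0 ≤ profileWeight (groupProb m) s :=
    profileWeight_nonneg groupProb_nonneg
  have hA : ∀ s : Fin n → Fin (m + 1),
      0 ≤ ∑ i, M.expAlloc n (fun _ => v) B (fun i => geometricCost κ (s i)) i * (v : ℝ) := fun s =>
    Finset.sum_nonneg fun i _ => mul_nonneg (M.expAlloc_nonneg _ _ _ _ _) v.2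
  calc _ ≤ ∑ s ∈ G, profileWeight (groupProb m) s *
        ((∑ i, M.expAlloc n (fun _ => v) B (fun i => geometricCost κ (s i)) i * (v : ℝ)) / K) := by
        refine Finset.sum_le_sum fun s hs => mul_le_mul_of_nonneg_left ?_ (hW s)
        -- The bound `K` does not depend on the profile `s`, so the averaged utility can be divided
        -- by it.
        have hopt : K ≤ (equalUtilityMarket hn hv fun i => geometricCost κ (s i)).opt B := by
          refine Market.line_le_opt _ (k := s) hκ' hη hm (fun i => ?_) (hG s hs) hB₁ hB₂
          rw [equalUtilityMarket_γ, coe_geometricCost]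
        unfold competitiveRatio
        rw [equalUtilityMarket_γ]
        exact div_le_div_of_nonneg_left (hA s) hK0 hopt
    _ = (∑ s ∈ G, profileWeight (groupProb m) s *
        ∑ i, M.expAlloc n (fun _ => v) B (fun i => geometricCost κ (s i)) i * (v : ℝ)) / K := by
        rw [Finset.sum_div]
        simp_rw [mul_div_assoc]
    _ ≤ (a + b * B) / K := by
        refine div_le_div_of_nonneg_right (le_trans ?_ hsum) hK0.le
        exact Finset.sum_le_sum_of_subset_of_nonneg (Finset.subset_univ _) fun s _ _ =>
          mul_nonneg (hW s) (hA s)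
    _ = _ := by
        have h1 : 1 - η ≠ 0 := by linarith
        have h2 : 1 + η ≠ 0 := by linarith
        have h3 : (1 + η) / (1 - η) * ((1 - η) / (1 + η)) = 1 := by field_simp
        have h4 : ∀ x r r' : ℝ, r * r' = 1 →
            x = (2 + √2) / 4 * r * (r' * ((4 - 2 * √2) * x)) := fun x r r' h => by
          linear_combination (x / 2) * sq_sqrt_two - (2 + √2) / 4 * (4 - 2 * √2) * x * h
        rw [hK, div_eq_iff hK0.ne']
        exact h4 _ _ _ h3

/-- For a random budget, the average over the nearly geometric markets among the randomly sampled
ones of the expected competitive ratio. -/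
lemma sum_profileWeight_integral_le {M : RandomizedMechanism Ω}
    (hT : M.TruthfulInExpectation) (hIR : M.IndividuallyRational) (hBF : M.BudgetFeasible)
    {n L : ℕ} (hn : 0 < n) {v : ℝ≥0} (hv : 0 < v) (hvn : (v : ℝ) * n = 2 ^ (L + 3))
    {κ : ℝ≥0} (hκ : 0 < κ) {η : ℝ} (hη : 0 ≤ η) (hη1 : η < 1)
    {G : Finset (Fin n → Fin (L + 3 + 1))}
    (hG : ∀ s ∈ G, ∀ j : Fin (L + 3 + 1),
      |∑ _i ∈ Finset.univ.filter (fun i => s i = j), (v : ℝ) - groupUtility j| ≤ η)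
    {D : Measure ℝ≥0} [IsProbabilityMeasure D] (hD : ∀ᵐ ρ ∂D, 0 < ρ)
    {B₀ : ℝ≥0} (hB₀ : 0 < B₀) {a b : ℝ≥0} (ha : 0 < a) (hκB : 2 * (κ : ℝ) = a * B₀)
    (hL : (b : ℝ) / a ≤ (2 + √2) ^ L) :
    ∑ s ∈ G, profileWeight (groupProb (L + 3)) s *
        ∫ ρ, M.competitiveRatio (equalUtilityMarket hn hv fun i => geometricCost κ (s i))
          (ρ * B₀) ∂D
      ≤ (2 + √2) / 4 * ((1 + η) / (1 - η)) + D.real (Set.Icc a b)ᶜ := by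
  have hl := sqrt_two_bounds.1
  have hB₀' : (0 : ℝ) < B₀ := by exact_mod_cast hB₀
  have ha' : (0 : ℝ) < a := by exact_mod_cast ha
  set mkt : (Fin n → Fin (L + 3 + 1)) → Market :=
    fun s => equalUtilityMarket hn hv fun i => geometricCost κ (s i) with hmkt
  set W := profileWeight (n := n) (groupProb (L + 3)) with hWdef
  have hW : ∀ s, 0 ≤ W s := profileWeight_nonneg groupProb_nonneg
  have hW1 : ∑ s, W s = 1 := sum_profileWeight (sum_groupProb (L + 3))
  have hint : ∀ s, Integrable (fun ρ => M.competitiveRatio (mkt s) (ρ * B₀)) D := fun s =>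
    M.integrable_competitiveRatio hIR hBF (mkt s) hD hB₀
  set C : ℝ := (2 + √2) / 4 * ((1 + η) / (1 - η)) with hC
  have hC0 : 0 ≤ C :=
    mul_nonneg (by positivity) (div_nonneg (by linarith) (by linarith))
  have hmeas : MeasurableSet (Set.Icc a b)ᶜ := measurableSet_Icc.compl
  have hind : Integrable ((Set.Icc a b)ᶜ.indicator (1 : ℝ≥0 → ℝ)) D :=
    (integrable_const (1 : ℝ)).indicator hmeas
  calc _ = ∫ ρ, ∑ s ∈ G, W s * M.competitiveRatio (mkt s) (ρ * B₀) ∂D := by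
        rw [integral_finsetSum _ fun s _ => (hint s).const_mul _]
        simp_rw [integral_const_mul]
        rfl
    _ ≤ ∫ ρ, (C + (Set.Icc a b)ᶜ.indicator 1 ρ) ∂D := by
        refine integral_mono_ae (integrable_finsetSum _ fun s _ => (hint s).const_mul _)
          ((integrable_const _).add hind) ?_
        filter_upwards [hD] with ρ hρ
        by_cases hρab : ρ ∈ Set.Icc a b
        · rw [Set.indicator_of_notMem (by simpa using hρab), add_zero]
          have hρa : (a : ℝ) ≤ ρ := by exact_mod_cast hρab.1
          have hρb : (ρ : ℝ) ≤ b := by exact_mod_cast hρab.2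
          -- `N` locates the budget between consecutive posted prices; `N ≤ L` leaves room for the
          -- groups up to `N + 3` used by the optimum.
          obtain ⟨N, hN1, hN2⟩ := exists_nat_pow_near (x := (ρ : ℝ) / a) (y := 2 + √2)
            ((one_le_div ha').2 hρa) (by linarith)
          have hNL : N ≤ L := by
            refine (pow_le_pow_iff_right₀ (show 1 < 2 + √2 by linarith)).1
              (hN1.trans (le_trans ?_ hL))
            gcongr
          rw [le_div_iff₀ ha'] at hN1
          rw [div_lt_iff₀ ha'] at hN2
          refine M.sum_profileWeight_competitiveRatio_le hT hIR hBF hn hv hvn hκ hη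
            hη1 (N := N) (by omega) hG ?_ ?_
          · rw [hκB, NNReal.coe_mul]
            nlinarith
          · rw [hκB, NNReal.coe_mul]
            nlinarith
        · rw [Set.indicator_of_mem (by simpa using hρab)]
          -- Outside `[a, b]` each ratio is at most `1`, and the weights sum to `1`.
          refine le_trans ?_ (le_add_of_nonneg_left hC0)
          rw [Pi.one_apply, ← hW1]
          refine le_trans (Finset.sum_le_sum fun s _ => mul_le_of_le_one_right (hW s)
            (M.competitiveRatio_le_one hIR hBF (mkt s) (mul_pos hρ hB₀))) ?_
          exact Finset.sum_le_sum_of_subset_of_nonneg (Finset.subset_univ _) fun s _ _ => hW s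
    _ = C + D.real (Set.Icc a b)ᶜ := by
        rw [integral_add (integrable_const _) hind,
          integral_indicator_one hmeas]
        simp

end RandomizedMechanism

/-- Hardness under every distribution of budget perturbations. The budget is `ρ * B₀` with `ρ`
drawn from `D`. For all `ε, δ > 0` there is a market, geometric up to `ε`, in which every seller's
cost is at most `δ * B₀`, and on which the expected competitive ratio is at most `0.854` and at
most `(2 + √2) / 4 + ε`. -/
theorem mainTheorem5 {Ω : Type*} [MeasurableSpace Ω]
    (D : Measure ℝ≥0) [IsProbabilityMeasure D] (hD : ∀ᵐ ρ ∂D, 0 < ρ)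
    (B₀ : ℝ≥0) (hB₀ : 0 < B₀)
    (M : RandomizedMechanism Ω) (hT : M.TruthfulInExpectation)
    (hIR : M.IndividuallyRational) (hBF : M.BudgetFeasible)
    (ε : ℝ) (hε : 0 < ε) (δ : ℝ≥0) (hδ : 0 < δ) :
    ∃ (I : Market) (m : ℕ) (κ : ℝ), 0 < κ ∧ I.IsNearlyGeometric m κ ε ∧
      (∀ i, I.c i ≤ δ * B₀) ∧
      Integrable (fun ρ => M.competitiveRatio I (ρ * B₀)) D ∧
      ∫ ρ, M.competitiveRatio I (ρ * B₀) ∂D ≤ 0.854 ∧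
      ∫ ρ, M.competitiveRatio I (ρ * B₀) ∂D ≤ (2 + √2) / 4 + ε := by
  obtain ⟨hl, hu⟩ := sqrt_two_bounds
  have hu' : √2 < 1.4143 := (Real.sqrt_lt' (by norm_num)).2 (by norm_num)
  -- `0.0004` fits between `(2 + √2) / 4 < 0.8536` and `0.854`.
  obtain ⟨τ, hτ, hτε, hτ1⟩ : ∃ τ : ℝ, 0 < τ ∧ τ ≤ ε ∧ τ ≤ 0.0004 :=
    ⟨min ε 0.0004, lt_min hε (by norm_num), min_le_left _ _, min_le_right _ _⟩
  obtain ⟨η, hη, hητ⟩ : ∃ η : ℝ, 0 < η ∧ 10 * η = τ := ⟨τ / 10, by positivity, by ring⟩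
  obtain ⟨a, b, ha, hDab⟩ := exists_measureReal_compl_Icc_lt D hD hη
  have hB₀' : (0 : ℝ) < B₀ := by exact_mod_cast hB₀
  have ha' : (0 : ℝ) < a := by exact_mod_cast ha
  obtain ⟨L, hL⟩ := pow_unbounded_of_one_lt ((b : ℝ) / a) (show 1 < 2 + √2 by linarith)
  set m := L + 3
  -- The lowest budget `a * B₀` becomes `2 * κ`, the cost of posting the price of group `1`.
  set κ : ℝ≥0 := a * B₀ / 2 with hκdef
  have hκ : 0 < κ := by positivity
  have hκB : 2 * (κ : ℝ) = a * B₀ := by rw [hκdef]; push_cast; ring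
  have hdB : (0 : ℝ) < δ * B₀ := mul_pos (by exact_mod_cast hδ) hB₀'
  -- The first term makes every seller's cost at most `δ * B₀`; the second makes the Chebyshev
  -- failure probability at most `η`.
  obtain ⟨n, hn1⟩ := exists_nat_gt
    (geometricCost κ m * 2 ^ m / (δ * B₀ : ℝ) + (m + 1 : ℕ) * (2 ^ m / η) ^ 2 / η)
  have hn : 0 < n := by
    have : (0 : ℝ) < n := lt_of_le_of_lt (by positivity) hn1
    exact_mod_cast this
  have hn' : (0 : ℝ) < n := by exact_mod_cast hn
  have hn2 : geometricCost κ m * 2 ^ m / (δ * B₀ : ℝ) < n :=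
    lt_of_le_of_lt (le_add_of_nonneg_right (by positivity)) hn1
  have hn3 : (m + 1 : ℕ) * (2 ^ m / η) ^ 2 / η < n :=
    lt_of_le_of_lt (le_add_of_nonneg_left (by positivity)) hn1
  set v : ℝ≥0 := 2 ^ m / n with hvdef
  have hv : 0 < v := div_pos (by positivity) (by exact_mod_cast hn)
  have hvn : (v : ℝ) * n = 2 ^ m := by rw [hvdef]; push_cast; field_simp
  set mkt : (Fin n → Fin (m + 1)) → Market :=
    fun s => equalUtilityMarket hn hv fun i => geometricCost κ (s i) with hmkt
  set G : Finset (Fin n → Fin (m + 1)) := Finset.univ.filter fun s => ∀ j : Fin (m + 1),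
    |∑ _i ∈ Finset.univ.filter (fun i => s i = j), (v : ℝ) - v * n * groupProb m j| ≤ η with hGdef
  have hG : ∀ s ∈ G, ∀ j : Fin (m + 1),
      |∑ _i ∈ Finset.univ.filter (fun i => s i = j), (v : ℝ) - groupUtility j| ≤ η := by
    intro s hs j
    have h := (Finset.mem_filter.1 hs).2 j
    rwa [hvn, groupProb, mul_div_cancel₀ _ (by positivity)] at h
  set W := profileWeight (n := n) (groupProb m) with hWdef
  have hW : ∀ s, 0 ≤ W s := profileWeight_nonneg groupProb_nonneg
  have hWG : 1 - η ≤ ∑ s ∈ G, W s := by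
    have h := one_sub_le_sum_profileWeight (n := n) (groupProb_nonneg (m := m))
      (sum_groupProb m) (v := (v : ℝ)) hη
    have h2 : Fintype.card (Fin (m + 1)) * ((v : ℝ) / η) ^ 2 * n ≤ η := by
      rw [Fintype.card_fin, show (v : ℝ) = 2 ^ m / n by rw [← hvn]; field_simp]
      rw [div_lt_iff₀ hη] at hn3
      have : ((m + 1 : ℕ) : ℝ) * (2 ^ m / n / η) ^ 2 * n = (m + 1 : ℕ) * (2 ^ m / η) ^ 2 / n := by
        field_simp
      rw [this, div_le_iff₀ hn']
      linarith
    exact le_trans (sub_le_sub_left h2 1)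
      (h.trans_eq (Finset.sum_congr (by ext; simp [hGdef]) fun _ _ => rfl))
  have hint : ∀ s, Integrable (fun ρ => M.competitiveRatio (mkt s) (ρ * B₀)) D := fun s =>
    M.integrable_competitiveRatio hIR hBF (mkt s) hD hB₀
  set C : ℝ := (2 + √2) / 4 * ((1 + η) / (1 - η)) with hC
  have havg : ∑ s ∈ G, W s * ∫ ρ, M.competitiveRatio (mkt s) (ρ * B₀) ∂D ≤ C + η :=
    (M.sum_profileWeight_integral_le hT hIR hBF hn hv hvn hκ hη.le (by linarith) hG hD hB₀ ha hκB
      hL.le).trans (by linarith)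
  -- If every profile in `G` exceeded the target, so would the average. The losses are below `4 * η`
  -- to first order, and `τ = 10 * η` absorbs them.
  obtain ⟨s, hs, hsτ⟩ : ∃ s ∈ G,
      ∫ ρ, M.competitiveRatio (mkt s) (ρ * B₀) ∂D ≤ (2 + √2) / 4 + τ := by
    by_contra! h
    have h1 : (1 - η) * ((2 + √2) / 4 + τ) ≤ C + η := by
      refine le_trans ?_ havg
      refine (mul_le_mul_of_nonneg_right hWG (by positivity)).trans ?_
      rw [Finset.sum_mul]
      exact Finset.sum_le_sum fun s hs => mul_le_mul_of_nonneg_left (h s hs).le (hW s)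
    have h2 : C * (1 - η) = (2 + √2) / 4 * (1 + η) := by
      have : 1 - η ≠ 0 := by linarith
      rw [hC]; field_simp
    have h3 := mul_le_mul_of_nonneg_right h1 (show 0 ≤ 1 - η by linarith)
    have h4 : 0 < η * (0.0001 - η) := mul_pos hη (by linarith)
    have h5 : 0 < η * (1 - (2 + √2) / 4) := mul_pos hη (by linarith)
    have h6 : 0 < η ^ 2 * ((2 + √2) / 4) := by positivity
    have h7 : 0 < η ^ 3 := by positivity
    rw [← hητ] at h3
    linarith
  refine ⟨mkt s, m, κ, by exact_mod_cast hκ, ⟨s, fun i => ?_, fun i i' _ => rfl, fun j => ?_⟩,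
    fun i => ?_, hint s, by linarith, by linarith⟩
  · rw [← coe_geometricCost]
    exact congrArg NNReal.toReal (congrFun (equalUtilityMarket_γ hn hv _) i)
  · exact (hG s hs j).trans (by linarith)
  · have h1 : geometricCost κ (s i) ≤ geometricCost κ m :=
      (geometricCost_strictMono hκ).monotone (Nat.lt_succ_iff.1 (s i).2)
    refine (mul_le_mul_left h1 v).trans ?_
    rw [← NNReal.coe_le_coe, NNReal.coe_mul, NNReal.coe_mul,
      show (v : ℝ) = 2 ^ m / n by rw [← hvn]; field_simp, mul_div_assoc', div_le_iff₀ hn']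
    rw [div_lt_iff₀ hdB] at hn2
    linarith
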